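/- All systems $A,B,\dots$ are non-zero finite-dimensional complex Hilbert spaces, $|A|$ denotes the dimension of $A$, $\log$ is the logarithm to base 2, and $\mathrm{CPTP}(A\to B)$ is the set of quantum channels (completely positive trace-preserving linear maps from operators on $A$ to operators on $B$). A state of $B$ is identified with the channel from the trivial system $\mathbb{C}$ to $B$ that prepares it. An isometry channel $\mathcal{V}\in\mathrm{CPTP}(A\to B)$ is a channel of the form $\rho\mapsto V\rho V^*$ with $V^*V=1_A$. A superchannel $\Theta$ from $\mathrm{CPTP}(A\to B)$ to $\mathrm{CPTP}(A'\to B)$ is a map of the form $\Theta[\mathcal{N}]=\mathcal{E}\circ(\mathsf{id}^R\otimes\mathcal{N})\circ\mathcal{W}$ with a system $R$, an isometry channel $\mathcal{W}\in\mathrm{CPTP}(A'\to RA)$ and a channel $\mathcal{E}\in\mathrm{CPTP}(RB\to B)$, regarded as acting on all linear maps $\mathcal{N}$ from operators on $A$ to operators on $B$; such a realization is in standard form if $|R|$ is the smallest possible among all realizations of $\Theta$. $\Theta$ is mixing if it has a realization in standard form for which $\mathcal{E}$ is conditionally unital, i.e. $\omega\mapsto\mathcal{E}(\tau\otimes\omega)$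 is a unital channel for every density matrix $\tau$ on $R$. For channels $\mathcal{N}\in\mathrm{CPTP}(A\to B)$ and $\mathcal{M}\in\mathrm{CPTP}(A'\to B)$ with the same output system, $\mathcal{N}\succ\mathcal{M}$ means that $\mathcal{M}=\Theta[\mathcal{N}]$ for some mixing superchannel $\Theta$. For $\mathcal{N}\in\mathrm{CPTP}(A\to B)$ and $\mathcal{M}\in\mathrm{CPTP}(A'\to B')$ in general, $\mathcal{N}\succ\mathcal{M}$ means that either $|B|>|B'|$ and $\mathcal{N}\succ\mathcal{U}\circ\mathcal{M}$ for some isometry channel $\mathcal{U}\in\mathrm{CPTP}(B'\to B)$, or $|B|\le|B'|$ and $\mathcal{U}\circ\mathcal{N}\succ\mathcal{M}$ for some isometry channel $\mathcal{U}\in\mathrm{CPTP}(B\to B')$. A (normalized) channel entropy is a function $\mathbb{H}:\bigcup_{A,B}\mathrm{CPTP}(A\to B)\to\mathbb{R}$, $\mathcal{N}\mapsto\mathbb{H}(B|A)_{\mathcal{N}}$, that is not identically zero and satisfies, for all channels $\mathcal{N}\in\mathrm{CPTP}(A\to B)$ and $\mathcal{M}\in\mathrm{CPTP}(A'\to B')$: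 (monotonicity) if $\mathcal{N}\succ\mathcal{M}$ then $\mathbb{H}(B|A)_{\mathcal{N}}\le\mathbb{H}(B'|A')_{\mathcal{M}}$; (additivity) $\mathbb{H}(BB'|AA')_{\mathcal{N}\otimes\mathcal{M}}=\mathbb{H}(B|A)_{\mathcal{N}}+\mathbb{H}(B'|A')_{\mathcal{M}}$; (normalization) the uniform qubit state has entropy $1$. **Theorem (inevitable negativity).** Let $\mathbb{H}$ be a channel entropy and let $\mathcal{V}\in\mathrm{CPTP}(A\to B)$ be an isometry channel. Then $$\mathbb{H}(B|A)_{\mathcal{V}}=-\log|A|.$$ In particular, every channel entropy takes a strictly negative value on some quantum channel. -/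

import Mathlib

open scoped Matrix Kronecker ComplexOrder

noncomputable section

/-- A finite-dimensional quantum system, i.e. a non-zero finite-dimensional Hilbert space with a
fixed orthonormal basis, given by the finite nonempty set labelling that basis. Operators on the
system are the complex matrices indexed by this set. -/
structure QSystem : Type 1 where
  carrier : Type
  [fintype : Fintype carrier]
  [decEq : DecidableEq carrier]
  [nonempty : Nonempty carrier]

namespace QSystem

instance : CoeSort QSystem Type := ⟨QSystem.carrier⟩

instance (A : QSystem) : Fintype A := A.fintype
instance (A : QSystem) : DecidableEq A := A.decEq
instance (A : QSystem) : Nonempty A := A.nonempty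

/-- The dimension `|A|`. -/
def dim (A : QSystem) : ℕ := Fintype.card A

/-- The composite system `AB`. -/
abbrev prod (A B : QSystem) : QSystem := ⟨A × B⟩

/-- The trivial (one-dimensional) system. -/
abbrev trivial : QSystem := ⟨Unit⟩

/-- The qubit. -/
abbrev qubit : QSystem := ⟨Fin 2⟩

end QSystem

/-- Linear maps from the operators on `A` to the operators on `B`. -/
abbrev SuperOp (A B : Type) : Type := Matrix A A ℂ →ₗ[ℂ] Matrix B B ℂ

namespace SuperOp

/-- `id_R ⊗ Φ`: apply `Φ` to every block of a matrix over `R × A`. -/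
def idTensor (R : Type) {A B : Type} (Φ : SuperOp A B) : SuperOp (R × A) (R × B) where
  toFun X := Matrix.of fun p q => Φ (Matrix.of fun a a' => X (p.1, a) (q.1, a')) p.2 q.2
  map_add' X Y := by
    ext p q
    exact congrFun (congrFun (Φ.map_add (Matrix.of fun a a' => X (p.1, a) (q.1, a'))
      (Matrix.of fun a a' => Y (p.1, a) (q.1, a'))) p.2) q.2
  map_smul' c X := by
    ext p q
    exact congrFun (congrFun (Φ.map_smul c (Matrix.of fun a a' => X (p.1, a) (q.1, a'))) p.2) q.2

/-- `Φ ⊗ id_R`. -/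
def tensorId (R : Type) {A B : Type} (Φ : SuperOp A B) : SuperOp (A × R) (B × R) where
  toFun X := Matrix.of fun p q => Φ (Matrix.of fun a a' => X (a, p.2) (a', q.2)) p.1 q.1
  map_add' X Y := by
    ext p q
    exact congrFun (congrFun (Φ.map_add (Matrix.of fun a a' => X (a, p.2) (a', q.2))
      (Matrix.of fun a a' => Y (a, p.2) (a', q.2))) p.1) q.1
  map_smul' c X := by
    ext p q
    exact congrFun (congrFun (Φ.map_smul c (Matrix.of fun a a' => X (a, p.2) (a', q.2))) p.1) q.1

/-- `Φ ⊗ Ψ = (Φ ⊗ id) ∘ (id ⊗ Ψ)`. -/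
def tensor {A B A' B' : Type} (Φ : SuperOp A B) (Ψ : SuperOp A' B') :
    SuperOp (A × A') (B × B') :=
  tensorId B' Φ ∘ₗ idTensor A Ψ

/-- Sanity check of the tensor product: on elementary tensors it acts factorwise. -/
theorem tensor_kronecker {A B A' B' : Type} (Φ : SuperOp A B) (Ψ : SuperOp A' B')
    (X : Matrix A A ℂ) (Y : Matrix A' A' ℂ) :
    tensor Φ Ψ (X ⊗ₖ Y) = Φ X ⊗ₖ Ψ Y := by
  ext ⟨b, b'⟩ ⟨c, c'⟩
  have h1 : ∀ a a' : A, (Ψ (Matrix.of fun x y => X a a' * Y x y)) b' c'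
      = X a a' * Ψ Y b' c' := fun a a' =>
    congrFun (congrFun (Ψ.map_smul (X a a') Y) b') c'
  have h2 : (Matrix.of fun a a' : A => (Ψ (Matrix.of fun x y => X a a' * Y x y)) b' c')
      = (Ψ Y b' c') • X := by
    ext a a'
    simp [h1, mul_comm]
  have h3 := congrFun (congrFun (Φ.map_smul (Ψ Y b' c') X) b) c
  change Φ (Matrix.of fun a a' : A => (Ψ (Matrix.of fun x y => X a a' * Y x y)) b' c') b c = _
  rw [h2, h3]
  simp [mul_comm]

/-- Complete positivity: `id_k ⊗ Φ` is positive for every `k`. -/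
def IsCompletelyPositive {A B : Type} (Φ : SuperOp A B) : Prop :=
  ∀ (k : ℕ) (X : Matrix (Fin k × A) (Fin k × A) ℂ),
    X.PosSemidef → (idTensor (Fin k) Φ X).PosSemidef

/-- Trace preservation. -/
def IsTracePreserving {A B : Type} [Fintype A] [Fintype B] (Φ : SuperOp A B) : Prop :=
  ∀ X : Matrix A A ℂ, (Φ X).trace = X.trace

theorem IsCompletelyPositive.ampl {A B : Type} {Φ : SuperOp A B} (h : Φ.IsCompletelyPositive)
    (R : Type) [Fintype R] {X : Matrix (R × A) (R × A) ℂ} (hX : X.PosSemidef) :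
    (idTensor R Φ X).PosSemidef := by
  let e := Fintype.equivFin R
  have h1 := h (Fintype.card R) _ (hX.submatrix (Prod.map e.symm id))
  have h2 := h1.submatrix (Prod.map e id)
  convert h2 using 1
  ext ⟨r, b⟩ ⟨s, c⟩
  simp [idTensor]

theorem IsCompletelyPositive.comp {A B C : Type} {Ψ : SuperOp B C} {Φ : SuperOp A B}
    (hΨ : Ψ.IsCompletelyPositive) (hΦ : Φ.IsCompletelyPositive) :
    SuperOp.IsCompletelyPositive (Ψ ∘ₗ Φ) :=
  fun k X hX => hΨ k _ (hΦ k X hX)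

theorem IsCompletelyPositive.idTensor {A B : Type} {Φ : SuperOp A B}
    (h : Φ.IsCompletelyPositive) (R : Type) [Fintype R] :
    (SuperOp.idTensor R Φ).IsCompletelyPositive := by
  intro k X hX
  have h1 := h.ampl (Fin k × R) (hX.submatrix (Equiv.prodAssoc (Fin k) R A))
  exact h1.submatrix (Equiv.prodAssoc (Fin k) R B).symm

theorem IsCompletelyPositive.tensorId {A B : Type} {Φ : SuperOp A B}
    (h : Φ.IsCompletelyPositive) (R : Type) [Fintype R] :
    (SuperOp.tensorId R Φ).IsCompletelyPositive := by
  intro k X hX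
  have h1 := h.ampl (Fin k × R)
    (hX.submatrix fun p : (Fin k × R) × A => (p.1.1, (p.2, p.1.2)))
  exact h1.submatrix fun p : Fin k × (B × R) => ((p.1, p.2.2), p.2.1)

theorem IsTracePreserving.idTensor {A B : Type} [Fintype A] [Fintype B] {Φ : SuperOp A B}
    (h : Φ.IsTracePreserving) (R : Type) [Fintype R] :
    (SuperOp.idTensor R Φ).IsTracePreserving := by
  intro X
  simp only [Matrix.trace, Fintype.sum_prod_type]
  exact Finset.sum_congr rfl fun r _ => h (Matrix.of fun a a' => X (r, a) (r, a'))

theorem IsTracePreserving.tensorId {A B : Type} [Fintype A] [Fintype B] {Φ : SuperOp A B}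
    (h : Φ.IsTracePreserving) (R : Type) [Fintype R] :
    (SuperOp.tensorId R Φ).IsTracePreserving := by
  intro X
  simp only [Matrix.trace, Fintype.sum_prod_type_right]
  exact Finset.sum_congr rfl fun r _ => h (Matrix.of fun a a' => X (a, r) (a', r))

end SuperOp

/-- Quantum channels, `CPTP(A → B)`. -/
structure Channel (A B : QSystem) where
  toMap : SuperOp A B
  completelyPositive : toMap.IsCompletelyPositive
  tracePreserving : toMap.IsTracePreserving

namespace Channel

/-- Composition `N ∘ M`. -/
def comp {A B C : QSystem} (N : Channel B C) (M : Channel A B) : Channel A C where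
  toMap := N.toMap ∘ₗ M.toMap
  completelyPositive := N.completelyPositive.comp M.completelyPositive
  tracePreserving X := (N.tracePreserving _).trans (M.tracePreserving X)

/-- The tensor product `N ⊗ M ∈ CPTP(AA' → BB')`. -/
def tensor {A B A' B' : QSystem} (N : Channel A B) (M : Channel A' B') :
    Channel (A.prod A') (B.prod B') where
  toMap := SuperOp.tensor N.toMap M.toMap
  completelyPositive :=
    (N.completelyPositive.tensorId B').comp (M.completelyPositive.idTensor A)
  tracePreserving X :=
    (N.tracePreserving.tensorId B' _).trans (M.tracePreserving.idTensor A X)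

/-- Isometry channels: `ρ ↦ V ρ V*` with `V* V = 1`. -/
def IsIsometry {A B : QSystem} (N : Channel A B) : Prop :=
  ∃ V : Matrix B A ℂ, Vᴴ * V = 1 ∧ ∀ X, N.toMap X = V * X * Vᴴ

end Channel

/-- Density matrices. -/
def IsDensity {A : QSystem} (ρ : Matrix A A ℂ) : Prop := ρ.PosSemidef ∧ ρ.trace = 1

/-- The maximally mixed state `1 / |B|`. -/
def uniformMatrix (B : QSystem) : Matrix B B ℂ := ((B.dim : ℂ)⁻¹) • (1 : Matrix B B ℂ)

theorem isDensity_uniformMatrix (B : QSystem) : IsDensity (uniformMatrix B) := by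
  constructor
  · exact Matrix.PosSemidef.one.smul (inv_nonneg.mpr (Nat.cast_nonneg _))
  · have : (Fintype.card B : ℂ) ≠ 0 := Nat.cast_ne_zero.mpr Fintype.card_ne_zero
    simp [uniformMatrix, QSystem.dim, this]

/-- A state of `B`, regarded as the channel with trivial input that prepares it. -/
def stateChannel {B : QSystem} (ρ : Matrix B B ℂ) (hρ : IsDensity ρ) :
    Channel QSystem.trivial B where
  toMap :=
    { toFun := fun X => X () () • ρ
      map_add' := fun X Y => by simp [add_smul]
      map_smul' := fun c X => by simp [mul_smul] }
  completelyPositive := fun k X hX =>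
    (hX.submatrix fun i : Fin k => (i, ())).kronecker hρ.1
  tracePreserving := fun X => by
    change (X () () • ρ).trace = X.trace
    rw [Matrix.trace_smul, hρ.2]
    simp [Matrix.trace]

/-- The uniform state `u^B`. -/
def uniformState (B : QSystem) : Channel QSystem.trivial B :=
  stateChannel (uniformMatrix B) (isDensity_uniformMatrix B)

/-- A realization of a superchannel transforming channels `A → B` into channels `A' → B`: a memory
system `R`, a pre-processing isometry channel `A' → RA` and a post-processing channel `RB → B`. -/
structure Realization (A B A' : QSystem) where
  R : QSystem
  pre : Channel A' (R.prod A)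
  pre_isometry : pre.IsIsometry
  post : Channel (R.prod B) B

namespace Realization

/-- The superchannel `N ↦ post ∘ (id_R ⊗ N) ∘ pre` that is realized. As usual it is regarded as a
map on all linear maps from operators on `A` to operators on `B`, not only on the channels. -/
def supermap {A B A' : QSystem} (r : Realization A B A') : SuperOp A B → SuperOp A' B :=
  fun Φ => r.post.toMap ∘ₗ SuperOp.idTensor r.R Φ ∘ₗ r.pre.toMap

/-- A realization is in standard form if its memory system has the least possible dimension among
all realizations of the same superchannel. -/
def IsStandardForm {A B A' : QSystem} (r : Realization A B A') : Prop :=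
  ∀ r' : Realization A B A', r'.supermap = r.supermap → r.R.dim ≤ r'.R.dim

end Realization

/-- `E ∈ CPTP(RB → B)` is conditionally unital if for every density matrix `τ` on `R` the channel
`ω ↦ E (τ ⊗ ω)` is doubly stochastic, i.e. unital. -/
def IsConditionallyUnital {R B : QSystem} (E : Channel (R.prod B) B) : Prop :=
  ∀ τ : Matrix R R ℂ, IsDensity τ → E.toMap (τ ⊗ₖ (1 : Matrix B B ℂ)) = 1

/-- A mixing superchannel: in standard form its post-processing is conditionally unital. -/
def IsMixing {A B A' : QSystem} (Θ : SuperOp A B → SuperOp A' B) : Prop :=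
  ∃ r : Realization A B A', r.supermap = Θ ∧ r.IsStandardForm ∧ IsConditionallyUnital r.post

/-- Channel majorization `N ≻ M` for channels with the same output system. -/
def MajorizesSame {A A' B : QSystem} (N : Channel A B) (M : Channel A' B) : Prop :=
  ∃ Θ : SuperOp A B → SuperOp A' B, IsMixing Θ ∧ M.toMap = Θ N.toMap

/-- Channel majorization `N ≻ M` for channels with arbitrary output systems. -/
def Majorizes {A B A' B' : QSystem} (N : Channel A B) (M : Channel A' B') : Prop :=
  (B'.dim < B.dim ∧ ∃ U : Channel B' B, U.IsIsometry ∧ MajorizesSame N (U.comp M)) ∨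
  (B.dim ≤ B'.dim ∧ ∃ V : Channel B B', V.IsIsometry ∧ MajorizesSame (V.comp N) M)

/-- A (normalized) channel entropy: a function on all quantum channels between finite-dimensional
systems that is not identically zero, monotone under channel majorization, additive under tensor
products, and takes the value `1` on the uniform qubit state. -/
structure IsChannelEntropy (H : (A B : QSystem) → Channel A B → ℝ) : Prop where
  nonzero : ∃ (A B : QSystem) (N : Channel A B), H A B N ≠ 0
  monotone : ∀ (A B A' B' : QSystem) (N : Channel A B) (M : Channel A' B'),
    Majorizes N M → H A B N ≤ H A' B' M
  additive : ∀ (A B A' B' : QSystem) (N : Channel A B) (M : Channel A' B'),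
    H (A.prod A') (B.prod B') (N.tensor M) = H A B N + H A' B' M
  normalized : H QSystem.trivial QSystem.qubit (uniformState QSystem.qubit) = 1

end

/-!
An isometry channel `V` and the identity on its input system majorize each other, so
`H V = H (id A)` depends only on `|A|`, and it decreases as `|A|` grows. A unitary error basis of
`A` gives two protocols: dense coding turns `id A ⊗ u A` into a pure basis state of `A ⊗ A`, and
teleportation turns this state back into `id A ⊗ u A`. Both are mixing superchannels, and pure
states have entropy `0`, so `H (id A) = -H (u A)`; for a qubit this is `-1`. Thus `-H (id A)` is a
monotone function of `|A|` that turns products into sums and equals `1` at `2`, which leaves only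
the logarithm.
-/

noncomputable section

namespace SuperOp

section Conj

variable {A B C : Type} [Fintype A]

/-- The conjugation `X ↦ K X K*`, the completely positive map with the single Kraus operator
`K`. -/
def conj (K : Matrix B A ℂ) : SuperOp A B where
  toFun X := K * X * Kᴴ
  map_add' X Y := by rw [Matrix.mul_add, Matrix.add_mul]
  map_smul' c X := by simp

theorem conj_apply (K : Matrix B A ℂ) (X : Matrix A A ℂ) : conj K X = K * X * Kᴴ := rfl

theorem conj_one [DecidableEq A] : conj (1 : Matrix A A ℂ) = LinearMap.id := by
  ext1 X
  simp [conj_apply]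

theorem conj_zero : conj (0 : Matrix B A ℂ) = 0 := by
  ext1 X
  simp [conj_apply]

theorem conj_comp_conj [Fintype B] (L : Matrix C B ℂ) (K : Matrix B A ℂ) :
    conj L ∘ₗ conj K = conj (L * K) := by
  ext1 X
  simp [conj_apply, Matrix.mul_assoc]

theorem idTensor_conj (R : Type) [Fintype R] [DecidableEq R] (K : Matrix B A ℂ) :
    idTensor R (conj K) = conj ((1 : Matrix R R ℂ) ⊗ₖ K) := by
  ext X ⟨r, b⟩ ⟨s, c⟩
  simp [idTensor, conj_apply, Matrix.mul_apply, Fintype.sum_prod_type, Matrix.one_apply,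
    apply_ite]

theorem isCompletelyPositive_conj [Finite B] (K : Matrix B A ℂ) :
    (conj K).IsCompletelyPositive := by
  intro k X hX
  rw [idTensor_conj]
  exact hX.mul_mul_conjTranspose_same _

end Conj

theorem isCompletelyPositive_sum {A B ι : Type} (s : Finset ι) {Φ : ι → SuperOp A B}
    (h : ∀ i, (Φ i).IsCompletelyPositive) : (∑ i ∈ s, Φ i).IsCompletelyPositive := by
  intro k X hX
  have hsum : idTensor (Fin k) (∑ i ∈ s, Φ i) X = ∑ i ∈ s, idTensor (Fin k) (Φ i) X := by
    ext p q
    simp [idTensor, Matrix.sum_apply]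
  rw [hsum]
  exact Matrix.posSemidef_sum s fun i _ => h i k X hX

theorem idTensor_kronecker (R : Type) {A B : Type} (Φ : SuperOp A B) (X : Matrix R R ℂ)
    (Y : Matrix A A ℂ) : idTensor R Φ (X ⊗ₖ Y) = X ⊗ₖ Φ Y :=
  tensor_kronecker LinearMap.id Φ X Y

/-- The partial trace over the first factor. -/
def traceLeft (R A : Type) [Fintype R] : SuperOp (R × A) A where
  toFun X := Matrix.of fun a a' => ∑ i, X (i, a) (i, a')
  map_add' X Y := by
    ext a a'
    simp [Finset.sum_add_distrib]
  map_smul' c X := by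
    ext a a'
    simp [Finset.mul_sum]

theorem traceLeft_apply {R A : Type} [Fintype R] (X : Matrix (R × A) (R × A) ℂ) (a a' : A) :
    traceLeft R A X a a' = ∑ i, X (i, a) (i, a') := rfl

theorem traceLeft_idTensor {R A B : Type} [Fintype R] (Φ : SuperOp A B)
    (X : Matrix (R × A) (R × A) ℂ) :
    traceLeft R B (idTensor R Φ X) = Φ (traceLeft R A X) := by
  have hX : traceLeft R A X = ∑ i, Matrix.of fun a a' => X (i, a) (i, a') := by
    ext a a'
    simp [traceLeft_apply, Matrix.sum_apply]
  ext b b'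
  rw [hX, map_sum, Matrix.sum_apply]
  rfl

theorem trace_traceLeft {R A : Type} [Fintype R] [Fintype A] (X : Matrix (R × A) (R × A) ℂ) :
    (traceLeft R A X).trace = X.trace := by
  simp [Matrix.trace, traceLeft_apply, Fintype.sum_prod_type_right]

theorem rank_traceLeft_conj_one_le {R A C : Type} [Fintype R] [Fintype A] [Fintype C]
    [DecidableEq C] (V : Matrix (R × A) C ℂ) :
    (traceLeft R A (conj V 1)).rank ≤ Fintype.card R * Fintype.card C := by
  let M : Matrix A (R × C) ℂ := Matrix.of fun a p => V (p.1, a) p.2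
  have hM : traceLeft R A (conj V 1) = M * Mᴴ := by
    ext a a'
    simp [traceLeft_apply, conj_apply, M, Matrix.mul_apply, Fintype.sum_prod_type]
  calc (traceLeft R A (conj V 1)).rank = (M * Mᴴ).rank := by rw [hM]
    _ ≤ M.rank := Matrix.rank_mul_le_left _ _
    _ ≤ Fintype.card (R × C) := Matrix.rank_le_card_width _
    _ = Fintype.card R * Fintype.card C := Fintype.card_prod _ _

end SuperOp

namespace Channel

variable {A B C : QSystem}

@[ext] theorem ext {N M : Channel A B} (h : N.toMap = M.toMap) : N = M := by
  cases N; cases M; cases h; rfl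

/-- The channel `X ↦ ∑ i, K i X (K i)*` with Kraus operators `K i`. -/
def ofKraus {ι : Type} [Fintype ι] (K : ι → Matrix B A ℂ) (hK : ∑ i, (K i)ᴴ * K i = 1) :
    Channel A B where
  toMap := ∑ i, SuperOp.conj (K i)
  completelyPositive :=
    SuperOp.isCompletelyPositive_sum _ fun i => SuperOp.isCompletelyPositive_conj (K i)
  tracePreserving X := by
    have htrace (i : ι) : (SuperOp.conj (K i) X).trace = ((K i)ᴴ * K i * X).trace := by
      rw [SuperOp.conj_apply, Matrix.trace_mul_comm, ← Matrix.mul_assoc]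
    simp only [LinearMap.sum_apply, Matrix.trace_sum, htrace]
    rw [← Matrix.trace_sum, ← Finset.sum_mul, hK, Matrix.one_mul]

theorem ofKraus_toMap_comp_conj {D ι : Type} [Fintype D] [Fintype ι]
    (K : ι → Matrix B A ℂ) (hK : ∑ i, (K i)ᴴ * K i = 1) (L : Matrix A D ℂ) :
    (ofKraus K hK).toMap ∘ₗ SuperOp.conj L = ∑ i, SuperOp.conj (K i * L) := by
  ext1 X
  simp [ofKraus, ← SuperOp.conj_comp_conj]

/-- The isometry channel `X ↦ V X V*`. -/
def ofIsometry (V : Matrix B A ℂ) (hV : Vᴴ * V = 1) : Channel A B where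
  toMap := SuperOp.conj V
  completelyPositive := SuperOp.isCompletelyPositive_conj V
  tracePreserving X := by
    rw [SuperOp.conj_apply, Matrix.trace_mul_comm, ← Matrix.mul_assoc, hV, Matrix.one_mul]

theorem isIsometry_ofIsometry (V : Matrix B A ℂ) (hV : Vᴴ * V = 1) :
    (ofIsometry V hV).IsIsometry :=
  ⟨V, hV, fun _ => rfl⟩

theorem IsIsometry.exists_eq_ofIsometry {N : Channel A B} (h : N.IsIsometry) :
    ∃ (V : Matrix B A ℂ) (hV : Vᴴ * V = 1), N = ofIsometry V hV := by
  obtain ⟨V, hV, hN⟩ := h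
  exact ⟨V, hV, ext (LinearMap.ext hN)⟩

theorem IsIsometry.comp {N : Channel B C} {M : Channel A B} (hN : N.IsIsometry)
    (hM : M.IsIsometry) : (N.comp M).IsIsometry := by
  obtain ⟨V, hV, rfl⟩ := hN.exists_eq_ofIsometry
  obtain ⟨W, hW, rfl⟩ := hM.exists_eq_ofIsometry
  refine ⟨V * W, ?_, fun X => congrArg (· X) (SuperOp.conj_comp_conj V W)⟩
  calc (V * W)ᴴ * (V * W) = Wᴴ * (Vᴴ * V) * W := by
        simp only [Matrix.conjTranspose_mul, Matrix.mul_assoc]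
    _ = 1 := by rw [hV, Matrix.mul_one, hW]

theorem IsIsometry.dim_le {N : Channel A B} (h : N.IsIsometry) : A.dim ≤ B.dim := by
  obtain ⟨V, hV, -⟩ := h
  calc A.dim = (Vᴴ * V).rank := by rw [hV, Matrix.rank_one, QSystem.dim]
    _ ≤ V.rank := Matrix.rank_mul_le_right _ _
    _ ≤ B.dim := Matrix.rank_le_card_height _

/-- The identity channel. -/
def id (A : QSystem) : Channel A A where
  toMap := LinearMap.id
  completelyPositive _ _ hX := hX
  tracePreserving _ := rfl

theorem isIsometry_id (A : QSystem) : (id A).IsIsometry := ⟨1, by simp, fun X => by simp [id]⟩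

theorem id_tensor_id (A B : QSystem) : (id A).tensor (id B) = id (A.prod B) := rfl

theorem IsIsometry.exists_leftInverse {N : Channel A B} (h : N.IsIsometry) (hBA : B.dim ≤ A.dim) :
    ∃ M : Channel B A, M.IsIsometry ∧ M.comp N = id A := by
  obtain ⟨V, hV, rfl⟩ := h.exists_eq_ofIsometry
  have hV' : Vᴴᴴ * Vᴴ = 1 := by
    rw [Matrix.conjTranspose_conjTranspose]
    exact (Matrix.mul_eq_one_comm_of_card_eq A B ℂ (h.dim_le.antisymm hBA)).mp hV
  refine ⟨ofIsometry Vᴴ hV', isIsometry_ofIsometry _ _, ext ?_⟩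
  change SuperOp.conj Vᴴ ∘ₗ SuperOp.conj V = LinearMap.id
  rw [SuperOp.conj_comp_conj, hV, SuperOp.conj_one]

theorem exists_isIsometry (h : A.dim ≤ B.dim) : ∃ V : Channel A B, V.IsIsometry := by
  obtain ⟨f⟩ := Function.Embedding.nonempty_of_card_le (α := A) (β := B) h
  have hV : ((1 : Matrix B B ℂ).submatrix _root_.id f)ᴴ *
      (1 : Matrix B B ℂ).submatrix _root_.id f = 1 := by
    rw [Matrix.conjTranspose_submatrix, Matrix.conjTranspose_one,
      Matrix.submatrix_mul _ _ _ _root_.id _ Function.bijective_id |>.symm]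
    simp [Matrix.submatrix_one_embedding]
  exact ⟨ofIsometry _ hV, isIsometry_ofIsometry _ hV⟩

/-- The channel induced by a relabelling of the basis vectors. -/
def relabel (e : A ≃ B) : Channel A B where
  toMap := (Matrix.reindexLinearEquiv ℂ ℂ e e).toLinearMap
  completelyPositive _ _ hX := hX.submatrix (Prod.map _root_.id e.symm)
  tracePreserving X := Equiv.sum_comp e.symm fun a => X a a

theorem isIsometry_relabel (e : A ≃ B) : (relabel e).IsIsometry := by
  refine ⟨(1 : Matrix A A ℂ).submatrix e.symm _root_.id, ?_, fun X => ?_⟩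
  · rw [Matrix.conjTranspose_submatrix, Matrix.conjTranspose_one,
      Matrix.submatrix_mul_equiv]
    simp
  · change X.submatrix e.symm e.symm = _
    rw [Matrix.conjTranspose_submatrix, Matrix.conjTranspose_one]
    ext a b
    simp [Matrix.mul_apply, Matrix.one_apply]

/-- The channel that discards its input. -/
def discard (A : QSystem) : Channel A QSystem.trivial :=
  ofKraus (fun a => Matrix.single () a 1) (by
    simp [Matrix.conjTranspose_single, Matrix.sum_single_one])

theorem toMap_eq_trace_smul_one (N : Channel A QSystem.trivial) (X : Matrix A A ℂ) :
    N.toMap X = X.trace • 1 := by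
  ext ⟨⟩ ⟨⟩
  rw [← N.tracePreserving X]
  simp [Matrix.trace]

theorem eq_id_trivial (N : Channel QSystem.trivial QSystem.trivial) :
    N = id QSystem.trivial := by
  ext X : 2
  rw [toMap_eq_trace_smul_one, toMap_eq_trace_smul_one]

end Channel

namespace Realization

variable {A B A' : QSystem}

theorem trace_supermap (r : Realization A B A') (Φ : SuperOp A B) (X : Matrix A' A' ℂ) :
    (r.supermap Φ X).trace = (Φ (SuperOp.traceLeft r.R A (r.pre.toMap X))).trace := by
  rw [← SuperOp.traceLeft_idTensor, SuperOp.trace_traceLeft]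
  exact r.post.tracePreserving _

theorem traceLeft_pre_eq_of_supermap_eq {r r' : Realization A B A'}
    (h : r.supermap = r'.supermap) (X : Matrix A' A' ℂ) :
    SuperOp.traceLeft r.R A (r.pre.toMap X) = SuperOp.traceLeft r'.R A (r'.pre.toMap X) := by
  ext a a'
  let Φ : SuperOp A B := (Matrix.entryLinearMap ℂ ℂ a a').smulRight (uniformMatrix B)
  have hΦ (Y : Matrix A A ℂ) : (Φ Y).trace = Y a a' := by
    simp [Φ, Matrix.trace_smul, (isDensity_uniformMatrix B).2]
  calc SuperOp.traceLeft r.R A (r.pre.toMap X) a a' = (r.supermap Φ X).trace := by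
        rw [trace_supermap, hΦ]
    _ = SuperOp.traceLeft r'.R A (r'.pre.toMap X) a a' := by rw [h, trace_supermap, hΦ]

theorem dim_le (r : Realization A B A') : A'.dim ≤ r.R.dim * A.dim :=
  r.pre_isometry.dim_le.trans_eq (Fintype.card_prod _ _)

theorem isStandardForm_of_mul_dim_le {r : Realization A B A'} (h : r.R.dim * A.dim ≤ A'.dim) :
    r.IsStandardForm := fun r' _ =>
  Nat.le_of_mul_le_mul_right (h.trans r'.dim_le) Fintype.card_pos

theorem rank_traceLeft_pre_one_le (r : Realization A B A') :
    (SuperOp.traceLeft r.R A (r.pre.toMap 1)).rank ≤ r.R.dim * A'.dim := by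
  obtain ⟨V, -, hV⟩ := r.pre_isometry
  rw [hV]
  exact SuperOp.rank_traceLeft_conj_one_le V

theorem isStandardForm_of_mul_dim_le_rank {r : Realization A B A'}
    (h : r.R.dim * A'.dim ≤ (SuperOp.traceLeft r.R A (r.pre.toMap 1)).rank) :
    r.IsStandardForm := fun r' hr' => by
  rw [← traceLeft_pre_eq_of_supermap_eq hr'] at h
  exact Nat.le_of_mul_le_mul_right (h.trans r'.rank_traceLeft_pre_one_le) Fintype.card_pos

end Realization

theorem IsConditionallyUnital.of_toMap_kronecker_one {R B : QSystem} {E : Channel (R.prod B) B}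
    (h : ∀ τ : Matrix R R ℂ, E.toMap (τ ⊗ₖ 1) = τ.trace • 1) : IsConditionallyUnital E :=
  fun τ hτ => by rw [h, hτ.2, one_smul]

theorem isConditionallyUnital_relabel_punitProd (B : QSystem) :
    IsConditionallyUnital (R := QSystem.trivial) (Channel.relabel (Equiv.punitProd B)) :=
  .of_toMap_kronecker_one fun τ => by
    ext b c
    change τ () () * (1 : Matrix B B ℂ) b c = _
    simp [Matrix.trace]

theorem MajorizesSame.of_comp {A A' B : QSystem} (N : Channel A B) {W : Channel A' A}
    (hW : W.IsIsometry) : MajorizesSame N (N.comp W) := by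
  let r : Realization A B A' :=
    { R := QSystem.trivial
      pre := (Channel.relabel (Equiv.punitProd A).symm).comp W
      pre_isometry := (Channel.isIsometry_relabel _).comp hW
      post := Channel.relabel (Equiv.punitProd B) }
  have hr : r.IsStandardForm := fun r' _ => Fintype.card_pos
  exact ⟨r.supermap, ⟨r, rfl, hr, isConditionallyUnital_relabel_punitProd B⟩, rfl⟩

theorem MajorizesSame.refl {A B : QSystem} (N : Channel A B) : MajorizesSame N N :=
  .of_comp N (Channel.isIsometry_id A)

theorem MajorizesSame.majorizes {A A' B : QSystem} {N : Channel A B} {M : Channel A' B}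
    (h : MajorizesSame N M) : Majorizes N M :=
  Or.inr ⟨le_rfl, Channel.id B, Channel.isIsometry_id B, h⟩

namespace Channel.IsIsometry

variable {A B : QSystem} {V : Channel A B}

theorem majorizes_id (hV : V.IsIsometry) : Majorizes V (Channel.id A) := by
  rcases lt_or_ge A.dim B.dim with hAB | hBA
  · exact Or.inl ⟨hAB, V, hV, .refl V⟩
  · obtain ⟨W, hW, hWV⟩ := hV.exists_leftInverse hBA
    exact Or.inr ⟨hBA, W, hW, hWV ▸ .refl _⟩

theorem id_majorizes (hV : V.IsIsometry) : Majorizes (Channel.id A) V :=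
  Or.inr ⟨hV.dim_le, V, hV, .refl V⟩

end Channel.IsIsometry

/-- A unitary error basis: `|α|²` unitary matrices that are orthogonal for the Hilbert–Schmidt
inner product. It is what teleportation and dense coding are built from. -/
structure IsUnitaryErrorBasis {α : Type} [Fintype α] [DecidableEq α]
    (U : α × α → Matrix α α ℂ) : Prop where
  unitary : ∀ j, (U j)ᴴ * U j = 1
  orthogonal : ∀ i j, ((U i)ᴴ * U j).trace = if i = j then (Fintype.card α : ℂ) else 0

/-- The Weyl operators, products of a translation and a multiplication by a character. -/
def weyl {F : Type} [CommRing F] [DecidableEq F] (ψ : AddChar F ℂ) (j : F × F) :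
    Matrix F F ℂ :=
  Matrix.of fun r c => if r = c + j.1 then ψ (j.2 * c) else 0

theorem conjTranspose_weyl_mul_weyl_apply {F : Type} [CommRing F] [Fintype F] [DecidableEq F]
    (ψ : AddChar F ℂ) (i j : F × F) (c c' : F) :
    ((weyl ψ i)ᴴ * weyl ψ j) c c' =
      if c + i.1 = c' + j.1 then ψ (j.2 * c' - i.2 * c) else 0 := by
  simp only [weyl, Matrix.mul_apply, Matrix.conjTranspose_apply, Matrix.of_apply, apply_ite,
    RCLike.star_def, ← AddChar.map_neg_eq_conj, star_zero, ite_mul, ← AddChar.map_add_eq_mul,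
    neg_add_eq_sub, zero_mul, mul_zero, Finset.sum_ite_eq', Finset.mem_univ, ↓reduceIte]
  grind

theorem isUnitaryErrorBasis_weyl {F : Type} [CommRing F] [Fintype F] [DecidableEq F]
    {ψ : AddChar F ℂ} (hψ : ψ.IsPrimitive) : IsUnitaryErrorBasis (weyl ψ) where
  unitary j := by
    ext c c'
    rw [conjTranspose_weyl_mul_weyl_apply, Matrix.one_apply]
    by_cases h : c = c' <;> simp [h]
  orthogonal i j := by
    have hdiag (c : F) : ((weyl ψ i)ᴴ * weyl ψ j) c c =
        if i.1 = j.1 then ψ (c * (j.2 - i.2)) else 0 := by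
      simp [conjTranspose_weyl_mul_weyl_apply, mul_sub, mul_comm]
    simp only [Matrix.trace, Matrix.diag, hdiag]
    by_cases h : i.1 = j.1
    · simp [h, AddChar.sum_mulShift _ hψ, sub_eq_zero, Prod.ext_iff, eq_comm]
    · simp [h, Prod.ext_iff]

namespace IsUnitaryErrorBasis

variable {α β : Type} [Fintype α] [DecidableEq α] [Fintype β] [DecidableEq β]

theorem reindex {U : α × α → Matrix α α ℂ} (hU : IsUnitaryErrorBasis U) (e : α ≃ β) :
    IsUnitaryErrorBasis fun j : β × β => Matrix.reindex e e (U (e.symm j.1, e.symm j.2)) where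
  unitary j := by simp [hU.unitary]
  orthogonal i j := by
    have htrace (X : Matrix α α ℂ) : (X.submatrix e.symm e.symm).trace = X.trace :=
      e.symm.sum_comp X.diag
    simp [htrace, hU.orthogonal, Prod.ext_iff, Fintype.card_congr e]

theorem exists_of_nonempty (α : Type) [Fintype α] [DecidableEq α] [Nonempty α] :
    ∃ U : α × α → Matrix α α ℂ, IsUnitaryErrorBasis U := by
  have : NeZero (Fintype.card α) := ⟨Fintype.card_ne_zero⟩
  have e : ZMod (Fintype.card α) ≃ α := Fintype.equivOfCardEq (ZMod.card _)
  exact ⟨_, (isUnitaryErrorBasis_weyl (ZMod.isPrimitive_stdAddChar _)).reindex e⟩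

end IsUnitaryErrorBasis

section UnitaryErrorBasis

variable {α : Type} [Fintype α]

/-- The matrix whose columns are the maximally entangled vectors `|U j⟩ / √|α|`, with a trivial
third factor so that it maps into `A.prod (A.prod QSystem.trivial)`. -/
def bellMatrix (U : α × α → Matrix α α ℂ) : Matrix (α × α × Unit) (α × α) ℂ :=
  ((√(Fintype.card α) : ℝ) : ℂ)⁻¹ • Matrix.of fun x j => U j x.1 x.2.1

theorem inv_sqrt_card_mul_self :
    ((√(Fintype.card α) : ℝ) : ℂ)⁻¹ * ((√(Fintype.card α) : ℝ) : ℂ)⁻¹ =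
      (Fintype.card α : ℂ)⁻¹ := by
  rw [← mul_inv, ← Complex.ofReal_mul, Real.mul_self_sqrt (Nat.cast_nonneg _),
    Complex.ofReal_natCast]

theorem bellMatrix_mul_star (U : α × α → Matrix α α ℂ) (x y : α × α × Unit) (i j : α × α) :
    bellMatrix U x i * star (bellMatrix U y j) =
      (Fintype.card α : ℂ)⁻¹ * (U i x.1 x.2.1 * star (U j y.1 y.2.1)) := by
  simp only [bellMatrix, Matrix.smul_apply, Matrix.of_apply, smul_eq_mul, star_mul', star_inv₀,
    Complex.star_def, Complex.conj_ofReal]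
  rw [mul_mul_mul_comm, inv_sqrt_card_mul_self]

theorem conjTranspose_bellMatrix_mul_kronecker_mul_apply [DecidableEq α]
    (U : α × α → Matrix α α ℂ) (τ : Matrix α α ℂ) (i j : α × α) :
    ((bellMatrix U)ᴴ * (τ ⊗ₖ (1 : Matrix (α × Unit) (α × Unit) ℂ)) * bellMatrix U) i j =
      (Fintype.card α : ℂ)⁻¹ * ((U i)ᴴ * τ * U j).trace := by
  simp only [bellMatrix, Matrix.conjTranspose_smul, Matrix.smul_mul, Matrix.mul_smul, smul_smul,
    star_inv₀, Complex.star_def, Complex.conj_ofReal, inv_sqrt_card_mul_self]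
  simp [Matrix.mul_apply, Fintype.sum_prod_type_right, Matrix.one_apply, Matrix.trace]

variable [DecidableEq α]

namespace IsUnitaryErrorBasis

variable {U : α × α → Matrix α α ℂ}

theorem mul_conjTranspose (hU : IsUnitaryErrorBasis U) (j : α × α) : U j * (U j)ᴴ = 1 :=
  mul_eq_one_comm.mp (hU.unitary j)

theorem trace_conjTranspose_mul_mul (hU : IsUnitaryErrorBasis U) (j : α × α)
    (X : Matrix α α ℂ) : ((U j)ᴴ * X * U j).trace = X.trace := by
  rw [Matrix.trace_mul_comm, ← Matrix.mul_assoc, hU.mul_conjTranspose, Matrix.one_mul]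

variable [Nonempty α]

theorem conjTranspose_bellMatrix_mul_bellMatrix (hU : IsUnitaryErrorBasis U) :
    (bellMatrix U)ᴴ * bellMatrix U = 1 := by
  ext i j
  have h := conjTranspose_bellMatrix_mul_kronecker_mul_apply U 1 i j
  simp only [Matrix.one_kronecker_one, Matrix.mul_one, hU.orthogonal] at h
  simp [h, Matrix.one_apply]

theorem bellMatrix_mul_conjTranspose_bellMatrix (hU : IsUnitaryErrorBasis U) :
    bellMatrix U * (bellMatrix U)ᴴ = 1 :=
  (Matrix.mul_eq_one_comm_of_card_eq _ _ ℂ (by simp)).mp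
    hU.conjTranspose_bellMatrix_mul_bellMatrix

theorem sum_mul_star (hU : IsUnitaryErrorBasis U) (a b a' b' : α) :
    ∑ j, U j a b * star (U j a' b') = if (a, b) = (a', b') then (Fintype.card α : ℂ) else 0 := by
  have h := congrFun₂ hU.bellMatrix_mul_conjTranspose_bellMatrix (a, b, ()) (a', b', ())
  simp only [Matrix.mul_apply, Matrix.conjTranspose_apply, bellMatrix_mul_star,
    ← Finset.mul_sum, Matrix.one_apply] at h
  rw [inv_mul_eq_iff_eq_mul₀ (Nat.cast_ne_zero.mpr Fintype.card_ne_zero)] at h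
  simpa using h

theorem sum_mul_mul_conjTranspose (hU : IsUnitaryErrorBasis U) (X : Matrix α α ℂ) :
    ∑ j, U j * X * (U j)ᴴ = (Fintype.card α * X.trace) • 1 := by
  ext a a'
  calc (∑ j, U j * X * (U j)ᴴ) a a'
      = ∑ b, ∑ b', X b b' * ∑ j, U j a b * star (U j a' b') := by
        simp only [Matrix.sum_apply, Matrix.mul_apply, Matrix.conjTranspose_apply, Finset.sum_mul,
          Finset.mul_sum, Finset.sum_comm (γ := α × α)]
        rw [Finset.sum_comm]
        exact Finset.sum_congr rfl fun b _ => Finset.sum_congr rfl fun b' _ =>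
          Finset.sum_congr rfl fun j _ => by ring
    _ = ((Fintype.card α * X.trace) • (1 : Matrix α α ℂ)) a a' := by
        simp only [hU.sum_mul_star]
        by_cases h : a = a' <;> simp [h, Matrix.trace, Finset.mul_sum, mul_comm]

end IsUnitaryErrorBasis

end UnitaryErrorBasis

namespace Channel

/-- The pure state `|b⟩⟨b|`. -/
def basisState {B : QSystem} (b : B) : Channel QSystem.trivial B :=
  ofIsometry (Matrix.single b () 1) (by
    ext ⟨⟩ ⟨⟩
    simp [Matrix.conjTranspose_single])

theorem basisState_apply {B : QSystem} (b : B) (X : Matrix Unit Unit ℂ) :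
    (basisState b).toMap X = Matrix.single b b (X () ()) := by
  simp [basisState, ofIsometry, SuperOp.conj_apply, Matrix.conjTranspose_single,
    Matrix.single_mul_mul_single]

/-- The complete dephasing channel, i.e. the measurement in the standard basis. -/
def dephase (J : QSystem) : Channel J J :=
  ofKraus (fun j => Matrix.single j j 1) (by
    simp [Matrix.conjTranspose_single, Matrix.sum_single_one])

theorem dephase_apply {J : QSystem} (X : Matrix J J ℂ) :
    (dephase J).toMap X = Matrix.diagonal X.diag := by
  simp [dephase, ofKraus, SuperOp.conj_apply, Matrix.conjTranspose_single,
    Matrix.single_mul_mul_single, ← Matrix.sum_single_eq_diagonal]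

theorem dephase_comp_basisState {J : QSystem} (j : J) :
    (dephase J).comp (basisState j) = basisState j := by
  ext X k l
  change (dephase J).toMap ((basisState j).toMap X) k l = _
  rw [dephase_apply, basisState_apply, Matrix.diagonal_apply]
  grind [Matrix.diag_apply]

/-- The channel applying `U j` to the first system, controlled by the basis state `j` of the
second system, which is then discarded. -/
def controlled {A B J : QSystem} (U : J → Matrix B A ℂ) (hU : ∀ j, (U j)ᴴ * U j = 1) :
    Channel (A.prod J) (B.prod QSystem.trivial) :=
  ofKraus (fun j => U j ⊗ₖ Matrix.single () j 1) (by
    simp only [Matrix.conjTranspose_kronecker, ← Matrix.mul_kronecker_mul, hU,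
      Matrix.conjTranspose_single, star_one, Matrix.single_mul_single_same, mul_one]
    ext ⟨a, k⟩ ⟨b, l⟩
    by_cases hab : a = b <;>
      simp [Matrix.sum_apply, Matrix.single_apply, Matrix.one_apply, hab, ite_and])

theorem controlled_comp_idTensor_basisState {A B J : QSystem} (U : J → Matrix B A ℂ)
    (hU : ∀ j, (U j)ᴴ * U j = 1) (j : J) :
    (controlled U hU).toMap ∘ₗ SuperOp.idTensor A (basisState j).toMap =
      SuperOp.conj (U j ⊗ₖ (1 : Matrix Unit Unit ℂ)) := by
  have hket (i : J) : Matrix.single () i (1 : ℂ) * Matrix.single j () (1 : ℂ) =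
      if i = j then (1 : Matrix Unit Unit ℂ) else 0 := by
    split_ifs with hij
    · subst hij
      rw [Matrix.single_mul_single_same]
      ext ⟨⟩ ⟨⟩
      simp
    · exact Matrix.single_mul_single_of_ne _ _ _ _ hij (1 : ℂ)
  rw [basisState, ofIsometry, SuperOp.idTensor_conj, controlled, ofKraus_toMap_comp_conj]
  simp only [← Matrix.mul_kronecker_mul, Matrix.mul_one, hket]
  rw [Finset.sum_eq_single j _ (by simp), if_pos rfl]
  intro i _ hij
  rw [if_neg hij, Matrix.kronecker_zero, SuperOp.conj_zero]

theorem controlled_kronecker_one {A B J : QSystem} (U : J → Matrix B A ℂ)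
    (hU : ∀ j, (U j)ᴴ * U j = 1) (X : Matrix A A ℂ) :
    (controlled U hU).toMap (X ⊗ₖ 1) = (∑ j, U j * X * (U j)ᴴ) ⊗ₖ (1 : Matrix Unit Unit ℂ) := by
  ext ⟨b, ⟨⟩⟩ ⟨b', ⟨⟩⟩
  simp [controlled, ofKraus, SuperOp.conj_apply, Matrix.conjTranspose_kronecker,
    ← Matrix.mul_kronecker_mul, Matrix.sum_apply]

/-- The channel `id ⊗ u`, which adjoins a uniform state to its input. -/
def adjoinUniform (A : QSystem) : Channel (A.prod QSystem.trivial) (A.prod A) :=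
  (id A).tensor (uniformState A)

theorem adjoinUniform_kronecker_one {A : QSystem} (X : Matrix A A ℂ) :
    (adjoinUniform A).toMap (X ⊗ₖ 1) = X ⊗ₖ uniformMatrix A := by
  have h : (uniformState A).toMap 1 = uniformMatrix A := one_smul ℂ _
  rw [← h]
  exact SuperOp.tensor_kronecker _ _ X 1

end Channel

section DenseCoding

variable {A : QSystem} {U : A.prod A → Matrix A A ℂ}

namespace IsUnitaryErrorBasis

/-- The isometry channel preparing the maximally entangled states of a unitary error basis. -/
def entangle (hU : IsUnitaryErrorBasis U) :
    Channel (A.prod A) (A.prod (A.prod QSystem.trivial)) :=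
  Channel.ofIsometry (bellMatrix U) hU.conjTranspose_bellMatrix_mul_bellMatrix

/-- The measurement in the basis of maximally entangled states of a unitary error basis. -/
def bellMeasurement (hU : IsUnitaryErrorBasis U) :
    Channel (A.prod (A.prod QSystem.trivial)) (A.prod A) :=
  (Channel.dephase (A.prod A)).comp <| Channel.ofIsometry (bellMatrix U)ᴴ <| by
    rw [Matrix.conjTranspose_conjTranspose, hU.bellMatrix_mul_conjTranspose_bellMatrix]

theorem bellMeasurement_comp_entangle (hU : IsUnitaryErrorBasis U) :
    hU.bellMeasurement.comp hU.entangle = Channel.dephase (A.prod A) := by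
  have h : SuperOp.conj (bellMatrix U)ᴴ ∘ₗ SuperOp.conj (bellMatrix U) = LinearMap.id := by
    rw [SuperOp.conj_comp_conj, hU.conjTranspose_bellMatrix_mul_bellMatrix, SuperOp.conj_one]
  exact Channel.ext (congrArg ((Channel.dephase (A.prod A)).toMap ∘ₗ ·) h)

theorem bellMeasurement_kronecker_one (hU : IsUnitaryErrorBasis U) (τ : Matrix A A ℂ) :
    hU.bellMeasurement.toMap (τ ⊗ₖ 1) = ((A.dim : ℂ)⁻¹ * τ.trace) • 1 := by
  change (Channel.dephase (A.prod A)).toMap (SuperOp.conj (bellMatrix U)ᴴ (τ ⊗ₖ 1)) = _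
  rw [Channel.dephase_apply, SuperOp.conj_apply, Matrix.conjTranspose_conjTranspose,
    Matrix.smul_one_eq_diagonal]
  congr 1
  ext j
  refine (conjTranspose_bellMatrix_mul_kronecker_mul_apply U τ j j).trans ?_
  rw [hU.trace_conjTranspose_mul_mul, QSystem.dim]

theorem bellMeasurement_comp_entangle_comp_basisState (hU : IsUnitaryErrorBasis U)
    (j : A.prod A) :
    hU.bellMeasurement.comp (hU.entangle.comp (Channel.basisState j)) =
      Channel.basisState j :=
  (congrArg (Channel.comp · (Channel.basisState j)) hU.bellMeasurement_comp_entangle).trans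
    (Channel.dephase_comp_basisState j)

theorem entangle_comp_basisState_one_apply (hU : IsUnitaryErrorBasis U) (j : A.prod A)
    (x y : A.prod (A.prod QSystem.trivial)) :
    (hU.entangle.comp (Channel.basisState j)).toMap 1 x y =
      (A.dim : ℂ)⁻¹ * (U j x.1 x.2.1 * star (U j y.1 y.2.1)) := by
  have h : (hU.entangle.comp (Channel.basisState j)).toMap 1 =
      SuperOp.conj (bellMatrix U) (Matrix.single j j 1) :=
    congrArg (SuperOp.conj (bellMatrix U)) (Channel.basisState_apply j 1)
  rw [h, SuperOp.conj_apply, QSystem.dim, ← bellMatrix_mul_star]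
  simp [Matrix.mul_apply, Matrix.single_apply, ite_and]

theorem traceLeft_entangle_basisState (hU : IsUnitaryErrorBasis U) (j : A.prod A) :
    SuperOp.traceLeft A (A × Unit) ((hU.entangle.comp (Channel.basisState j)).toMap 1) =
      (A.dim : ℂ)⁻¹ • 1 := by
  ext ⟨b, ⟨⟩⟩ ⟨b', ⟨⟩⟩
  calc ∑ a, (hU.entangle.comp (Channel.basisState j)).toMap 1 (a, b, ()) (a, b', ())
      = (A.dim : ℂ)⁻¹ * ((U j)ᴴ * U j) b' b := by
        rw [Matrix.mul_apply, Finset.mul_sum]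
        refine Finset.sum_congr rfl fun a _ => ?_
        rw [Matrix.conjTranspose_apply, mul_comm (star _)]
        exact hU.entangle_comp_basisState_one_apply j (a, b, ()) (a, b', ())
    _ = ((A.dim : ℂ)⁻¹ • (1 : Matrix (A × Unit) (A × Unit) ℂ)) (b, ()) (b', ()) := by
        simp [hU.unitary, Matrix.one_apply, eq_comm]

/-- The decoder of dense coding, which discards the third system and measures. -/
def denseDecoder (hU : IsUnitaryErrorBasis U) : Channel (A.prod (A.prod A)) (A.prod A) :=
  hU.bellMeasurement.comp ((Channel.id A).tensor ((Channel.id A).tensor (Channel.discard A)))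

theorem isConditionallyUnital_denseDecoder (hU : IsUnitaryErrorBasis U) :
    IsConditionallyUnital hU.denseDecoder :=
  .of_toMap_kronecker_one fun τ => by
    have hdiscard : SuperOp.idTensor A (SuperOp.idTensor A (Channel.discard A).toMap)
        (τ ⊗ₖ (1 : Matrix (A × A) (A × A) ℂ)) =
          (A.dim : ℂ) • (τ ⊗ₖ (1 : Matrix (A × Unit) (A × Unit) ℂ)) := by
      rw [SuperOp.idTensor_kronecker, ← Matrix.one_kronecker_one, SuperOp.idTensor_kronecker,
        Channel.toMap_eq_trace_smul_one, Matrix.trace_one, Matrix.kronecker_smul,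
        Matrix.kronecker_smul, Matrix.one_kronecker_one, QSystem.dim]
    refine (congrArg hU.bellMeasurement.toMap hdiscard).trans ?_
    rw [map_smul]
    refine (congrArg ((A.dim : ℂ) • ·) (hU.bellMeasurement_kronecker_one τ)).trans ?_
    rw [smul_smul, mul_inv_cancel_left₀ (Nat.cast_ne_zero.mpr Fintype.card_ne_zero)]

/-- The realization of the superchannel with decoder `denseDecoder`, with which dense coding
recovers the message `j`. -/
def denseCoding (hU : IsUnitaryErrorBasis U) (j : A.prod A) :
    Realization (A.prod QSystem.trivial) (A.prod A) QSystem.trivial where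
  R := A
  pre := hU.entangle.comp (Channel.basisState j)
  pre_isometry :=
    (Channel.isIsometry_ofIsometry _ _).comp (Channel.isIsometry_ofIsometry _ _)
  post := hU.denseDecoder

theorem supermap_denseCoding (hU : IsUnitaryErrorBasis U) (j : A.prod A) :
    (hU.denseCoding j).supermap (Channel.adjoinUniform A).toMap =
      (Channel.basisState j).toMap := by
  have h := congrArg Channel.toMap
    (Channel.eq_id_trivial ((Channel.discard A).comp (uniformState A)))
  refine (congrArg (fun Φ => hU.bellMeasurement.toMap ∘ₗ
    SuperOp.idTensor A (SuperOp.idTensor A Φ) ∘ₗ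
      (hU.entangle.comp (Channel.basisState j)).toMap) h).trans ?_
  exact congrArg Channel.toMap (hU.bellMeasurement_comp_entangle_comp_basisState j)

theorem isStandardForm_denseCoding (hU : IsUnitaryErrorBasis U) (j : A.prod A) :
    (hU.denseCoding j).IsStandardForm := by
  have hd : (A.dim : ℂ)⁻¹ ∈ nonZeroDivisors ℂ :=
    mem_nonZeroDivisors_of_ne_zero (inv_ne_zero (Nat.cast_ne_zero.mpr Fintype.card_ne_zero))
  apply Realization.isStandardForm_of_mul_dim_le_rank
  calc A.dim * QSystem.trivial.dim
      = (1 : Matrix (A × Unit) (A × Unit) ℂ).rank := by simp [QSystem.dim]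
    _ = ((A.dim : ℂ)⁻¹ • (1 : Matrix (A × Unit) (A × Unit) ℂ)).rank :=
        (Matrix.rank_smul_of_mem_nonZeroDivisors _ hd).symm
    _ ≤ _ := (congrArg Matrix.rank (hU.traceLeft_entangle_basisState j)).ge

theorem adjoinUniform_majorizesSame_basisState (hU : IsUnitaryErrorBasis U) (j : A.prod A) :
    MajorizesSame (Channel.adjoinUniform A) (Channel.basisState j) :=
  ⟨(hU.denseCoding j).supermap,
    ⟨_, rfl, hU.isStandardForm_denseCoding j, hU.isConditionallyUnital_denseDecoder⟩,
    (hU.supermap_denseCoding j).symm⟩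

end IsUnitaryErrorBasis

end DenseCoding

section Teleportation

variable {A : QSystem} {U : A.prod A → Matrix A A ℂ}

namespace IsUnitaryErrorBasis

/-- The correction step of teleportation: apply `U j` to the first system, where `j` is read off
the other two, and replace these by a uniform system. -/
def teleportCorrection (hU : IsUnitaryErrorBasis U) : Channel (A.prod (A.prod A)) (A.prod A) :=
  (Channel.adjoinUniform A).comp (Channel.controlled U hU.unitary)

theorem isConditionallyUnital_teleportCorrection (hU : IsUnitaryErrorBasis U) :
    IsConditionallyUnital hU.teleportCorrection :=
  .of_toMap_kronecker_one fun τ => by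
    have hcontrolled : (Channel.controlled U hU.unitary).toMap (τ ⊗ₖ 1) =
        ((A.dim * τ.trace) • 1) ⊗ₖ (1 : Matrix Unit Unit ℂ) :=
      (Channel.controlled_kronecker_one U hU.unitary τ).trans
        (congrArg (· ⊗ₖ 1) (hU.sum_mul_mul_conjTranspose τ))
    calc (Channel.adjoinUniform A).toMap
          ((Channel.controlled U hU.unitary).toMap (τ ⊗ₖ 1))
        = ((A.dim * τ.trace) • 1) ⊗ₖ uniformMatrix A := by
          rw [hcontrolled, Channel.adjoinUniform_kronecker_one]
      _ = τ.trace • 1 := by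
          rw [uniformMatrix, Matrix.smul_kronecker, Matrix.kronecker_smul, smul_smul,
            Matrix.one_kronecker_one, mul_right_comm,
            mul_inv_cancel₀ (Nat.cast_ne_zero.mpr Fintype.card_ne_zero), one_mul]

/-- The realization that undoes `U j` before `teleportCorrection` applies it again. -/
def teleportation (hU : IsUnitaryErrorBasis U) (j : A.prod A) :
    Realization QSystem.trivial (A.prod A) (A.prod QSystem.trivial) where
  R := A
  pre := Channel.ofIsometry ((U j)ᴴ ⊗ₖ (1 : Matrix Unit Unit ℂ)) (by
    rw [Matrix.conjTranspose_kronecker, ← Matrix.mul_kronecker_mul,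
      Matrix.conjTranspose_conjTranspose, hU.mul_conjTranspose, Matrix.conjTranspose_one,
      Matrix.one_mul, Matrix.one_kronecker_one])
  pre_isometry := Channel.isIsometry_ofIsometry _ _
  post := hU.teleportCorrection

theorem supermap_teleportation (hU : IsUnitaryErrorBasis U) (j : A.prod A) :
    (hU.teleportation j).supermap (Channel.basisState j).toMap =
      (Channel.adjoinUniform A).toMap := by
  have hU1 : (U j ⊗ₖ (1 : Matrix Unit Unit ℂ)) * ((U j)ᴴ ⊗ₖ (1 : Matrix Unit Unit ℂ)) = 1 := by
    rw [← Matrix.mul_kronecker_mul, hU.mul_conjTranspose, Matrix.one_mul,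
      Matrix.one_kronecker_one]
  have hcontrolled := Channel.controlled_comp_idTensor_basisState U hU.unitary j
  have hcancel := SuperOp.conj_comp_conj (U j ⊗ₖ (1 : Matrix Unit Unit ℂ))
    ((U j)ᴴ ⊗ₖ (1 : Matrix Unit Unit ℂ))
  rw [hU1, SuperOp.conj_one, ← hcontrolled] at hcancel
  ext1 X
  exact congrArg (Channel.adjoinUniform A).toMap (LinearMap.congr_fun hcancel X)

theorem isStandardForm_teleportation (hU : IsUnitaryErrorBasis U) (j : A.prod A) :
    (hU.teleportation j).IsStandardForm :=
  Realization.isStandardForm_of_mul_dim_le (Fintype.card_prod A Unit).ge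

theorem basisState_majorizesSame_adjoinUniform (hU : IsUnitaryErrorBasis U) (j : A.prod A) :
    MajorizesSame (Channel.basisState j) (Channel.adjoinUniform A) :=
  ⟨(hU.teleportation j).supermap,
    ⟨_, rfl, hU.isStandardForm_teleportation j, hU.isConditionallyUnital_teleportCorrection⟩,
    (hU.supermap_teleportation j).symm⟩

end IsUnitaryErrorBasis

end Teleportation

section Logarithm

theorem map_pow_eq_mul {M : Type*} [Monoid M] {f : M → ℝ}
    (hmul : ∀ m n, f (m * n) = f m + f n) (n : M) (k : ℕ) :
    f (n ^ k) = k * f n := by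
  induction k with
  | zero => simpa using hmul 1 1
  | succ k ih => rw [pow_succ, hmul, ih]; push_cast; ring

theorem abs_sub_logb_le_one {f : ℕ+ → ℝ} (hf : Monotone f)
    (hmul : ∀ m n, f (m * n) = f m + f n) {b : ℕ+} (hb : 1 < b) (hfb : f b = 1) (n : ℕ+) :
    |f n - Real.logb b n| ≤ 1 := by
  have hb' : 1 < (b : ℕ) := hb
  have hpow (k : ℕ) : f (b ^ k) = k := by rw [map_pow_eq_mul hmul, hfb, mul_one]
  have hlower : b ^ Nat.log b n ≤ n := by
    rw [← PNat.coe_le_coe, PNat.pow_coe]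
    exact Nat.pow_log_le_self b n.ne_zero
  have hupper : n ≤ b ^ (Nat.log b n + 1) := by
    rw [← PNat.coe_le_coe, PNat.pow_coe]
    exact (Nat.lt_pow_succ_log_self hb' n).le
  have hf_lower := hf hlower
  have hf_upper := hf hupper
  have hfloor := Real.natFloor_logb_natCast b n
  have hlog_nonneg : 0 ≤ Real.logb b n :=
    Real.logb_nonneg (Nat.one_lt_cast.mpr hb') (Nat.one_le_cast.mpr n.pos)
  have hlog_lower := Nat.floor_le hlog_nonneg
  have hlog_upper := Nat.lt_floor_add_one (Real.logb b n)
  rw [hfloor] at hlog_lower hlog_upper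
  rw [hpow] at hf_lower hf_upper
  push_cast at hf_upper
  rw [abs_le]
  constructor <;> linarith

theorem eq_logb_of_monotone_of_map_mul {f : ℕ+ → ℝ} (hf : Monotone f)
    (hmul : ∀ m n, f (m * n) = f m + f n) {b : ℕ+} (hb : 1 < b) (hfb : f b = 1) (n : ℕ+) :
    f n = Real.logb b n := by
  -- Passing from `n` to `n ^ k` multiplies the error by `k`.
  have hbound (k : ℕ) : k * |f n - Real.logb b n| ≤ 1 := by
    have h := abs_sub_logb_le_one hf hmul hb hfb (n ^ k)
    rwa [map_pow_eq_mul hmul, PNat.pow_coe, Nat.cast_pow, Real.logb_pow, ← mul_sub, abs_mul,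
      Nat.abs_cast] at h
  by_contra hne
  obtain ⟨k, hk⟩ := exists_nat_gt |f n - Real.logb b n|⁻¹
  have hpos : 0 < |f n - Real.logb b n| := abs_pos.mpr (sub_ne_zero.mpr hne)
  exact absurd (hbound k) (not_le.mpr ((inv_lt_iff_one_lt_mul₀ hpos).mp hk))

end Logarithm

namespace IsChannelEntropy

variable {H : (A B : QSystem) → Channel A B → ℝ} {A B : QSystem}

theorem isometry_eq_id (hH : IsChannelEntropy H) {V : Channel A B} (hV : V.IsIsometry) :
    H A B V = H A A (Channel.id A) :=
  le_antisymm (hH.monotone _ _ _ _ _ _ hV.majorizes_id) (hH.monotone _ _ _ _ _ _ hV.id_majorizes)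

theorem id_antitone (hH : IsChannelEntropy H) (h : A.dim ≤ B.dim) :
    H B B (Channel.id B) ≤ H A A (Channel.id A) := by
  obtain ⟨V, hV⟩ := Channel.exists_isIsometry h
  rw [← hH.isometry_eq_id hV]
  exact hH.monotone _ _ _ _ _ _ (MajorizesSame.of_comp (Channel.id B) hV).majorizes

theorem id_congr (hH : IsChannelEntropy H) (h : A.dim = B.dim) :
    H A A (Channel.id A) = H B B (Channel.id B) :=
  le_antisymm (hH.id_antitone h.ge) (hH.id_antitone h.le)

theorem id_prod (hH : IsChannelEntropy H) (A B : QSystem) :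
    H _ _ (Channel.id (A.prod B)) = H A A (Channel.id A) + H B B (Channel.id B) := by
  rw [← hH.additive, Channel.id_tensor_id]

theorem id_trivial (hH : IsChannelEntropy H) : H _ _ (Channel.id QSystem.trivial) = 0 := by
  have h := hH.id_prod QSystem.trivial QSystem.trivial
  rw [hH.id_congr (A := QSystem.trivial.prod QSystem.trivial) (B := QSystem.trivial) rfl] at h
  exact left_eq_add.mp h

theorem id_eq_neg_uniformState (hH : IsChannelEntropy H) (A : QSystem) :
    H A A (Channel.id A) = -H _ A (uniformState A) := by
  obtain ⟨U, hU⟩ := IsUnitaryErrorBasis.exists_of_nonempty A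
  let j : A.prod A := Classical.arbitrary _
  have hpure : H _ _ (Channel.basisState j) = 0 :=
    (hH.isometry_eq_id (Channel.isIsometry_ofIsometry _ _)).trans hH.id_trivial
  have hadjoin : H _ _ (Channel.adjoinUniform A) = H _ _ (Channel.basisState j) :=
    le_antisymm
      (hH.monotone _ _ _ _ _ _ (hU.adjoinUniform_majorizesSame_basisState j).majorizes)
      (hH.monotone _ _ _ _ _ _ (hU.basisState_majorizesSame_adjoinUniform j).majorizes)
  rw [hpure, Channel.adjoinUniform, hH.additive] at hadjoin
  exact eq_neg_of_add_eq_zero_left hadjoin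

theorem id_qubit (hH : IsChannelEntropy H) : H _ _ (Channel.id QSystem.qubit) = -1 := by
  rw [hH.id_eq_neg_uniformState, hH.normalized]

theorem id_eq (hH : IsChannelEntropy H) (A : QSystem) :
    H A A (Channel.id A) = -Real.logb 2 A.dim := by
  let S (n : ℕ+) : QSystem := ⟨Fin n⟩
  have hS (n : ℕ+) : (S n).dim = n := Fintype.card_fin n
  have hmono : Monotone fun n => -H _ _ (Channel.id (S n)) := fun m n hmn =>
    neg_le_neg (hH.id_antitone (by rwa [hS, hS, PNat.coe_le_coe]))
  have hmul (m n : ℕ+) : -H _ _ (Channel.id (S (m * n))) =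
      -H _ _ (Channel.id (S m)) + -H _ _ (Channel.id (S n)) := by
    have hdim : (S (m * n)).dim = ((S m).prod (S n)).dim := by
      rw [hS, PNat.mul_coe]
      exact ((Fintype.card_prod _ _).trans (congrArg₂ _ (hS m) (hS n))).symm
    rw [hH.id_congr hdim, hH.id_prod, neg_add]
  have htwo : -H _ _ (Channel.id (S 2)) = 1 := by
    rw [hH.id_congr (A := S 2) (B := QSystem.qubit) rfl, hH.id_qubit, neg_neg]
  let d : ℕ+ := ⟨A.dim, Fintype.card_pos⟩
  have hlog := eq_logb_of_monotone_of_map_mul hmono hmul (b := 2) (by decide) htwo d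
  rw [hH.id_congr (hS d).symm, ← neg_eq_iff_eq_neg]
  exact hlog.trans (by rw [PNat.val_ofNat, Nat.cast_ofNat]; rfl)

end IsChannelEntropy

end

theorem theorem17 (H : (A B : QSystem) → Channel A B → ℝ) (hH : IsChannelEntropy H) :
    (∀ (A B : QSystem) (V : Channel A B), V.IsIsometry →
      H A B V = -Real.logb 2 (A.dim : ℝ)) ∧
    ∃ (A B : QSystem) (N : Channel A B), H A B N < 0 := by
  refine ⟨fun A B V hV => (hH.isometry_eq_id hV).trans (hH.id_eq A), ?_⟩
  exact ⟨_, _, Channel.id QSystem.qubit, by rw [hH.id_qubit]; norm_num⟩
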